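/- Let $T$ binary classification tasks be given, the $m$-th one by a nonempty finite dataset $S_m$ of pairs $(x,y)\in\mathbb{R}^D\times\{-1,+1\}$, with feasible set $\mathcal{W}_m=\{w\in\mathbb{R}^D : y\,w^\top x\ge 1\ \ \forall (x,y)\in S_m\}$. The datasets are called separable if $\mathcal{W}_m\neq\emptyset$ for every $m$. For positive definite $B\in\mathbb{R}^{D\times D}$ write $\|v\|_B=\sqrt{v^\top B v}$. Fix the dataset sizes and the labels. Then for Lebesgue-almost every choice of the sample vectors $x$ for which the datasets are separable, the following holds for every $k\in\mathbb{N}$, every sequence of tasks $\tau(1),\dots,\tau(k)\in\{1,\dots,T\}$ (repetitions allowed) and all symmetric positive definite matrices $B_1,\dots,B_k$ with $0<\mu\le\sigma_{\min}(B_t)\le\sigma_{\max}(B_t)\le M<\infty$ for all $t$. For every $\lambda>0$ the regularized iterates $$w_0^{(\lambda)}=0,\qquad w_t^{(\lambda)}=\operatorname*{argmin}_{w\in\mathbb{R}^D}\ \sum_{(x,y)\in S_{\tau(t)}}e^{-y\,w^\top x}+\frac{\lambda}{2}\,\bigl\|w-w_{t-1}^{(\lambda)}\bigr\|_{B_t}^2\qquad(t=1,\dots,k)$$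 and the weighted Sequential Max-Margin iterates $$w_0=0,\qquad w_t=\operatorname*{argmin}_{w\in\mathcal{W}_{\tau(t)}}\ \|w-w_{t-1}\|_{B_t}^2\qquad(t=1,\dots,k)$$ are well defined (every minimizer exists and is unique), and for every $t\in\{1,\dots,k\}$ one has $w_t\neq 0$ and $$\lim_{\lambda\to 0^+}\frac{w_t^{(\lambda)}}{\|w_t^{(\lambda)}\|}=\frac{w_t}{\|w_t\|},$$ where $\|\cdot\|$ is the Euclidean norm. -/

import Mathlib

open Filter Topology MeasureTheory

noncomputable section

namespace ContinualClassification

/-- The weighted norm `‖v‖_B = √(vᵀ B v)` (a norm when `B` is positive definite). -/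
def weightedNorm {D : ℕ} (B : Matrix (Fin D) (Fin D) ℝ) (v : EuclideanSpace ℝ (Fin D)) : ℝ :=
  Real.sqrt (v.ofLp ⬝ᵥ B.mulVec v.ofLp)

/-- The feasible set of one task with samples `x i` and labels `y i`:
all `w` with `y i * wᵀ x i ≥ 1` for every sample. -/
def feasibleSet {D N : ℕ} (x : Fin N → EuclideanSpace ℝ (Fin D)) (y : Fin N → ℝ) :
    Set (EuclideanSpace ℝ (Fin D)) :=
  {w | ∀ i, 1 ≤ y i * inner ℝ w (x i)}

/-- The exponential loss of one task. -/
def expLoss {D N : ℕ} (x : Fin N → EuclideanSpace ℝ (Fin D)) (y : Fin N → ℝ)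
    (w : EuclideanSpace ℝ (Fin D)) : ℝ :=
  ∑ i, Real.exp (-(y i * inner ℝ w (x i)))

/-- The objective of one step of regularized continual learning: the exponential loss of the
current task plus the weighted penalty that biases towards the previous iterate `u`. -/
def regularizedObjective {D N : ℕ} (x : Fin N → EuclideanSpace ℝ (Fin D)) (y : Fin N → ℝ)
    (B : Matrix (Fin D) (Fin D) ℝ) (lam : ℝ) (u w : EuclideanSpace ℝ (Fin D)) : ℝ :=
  expLoss x y w + lam / 2 * weightedNorm B (w - u) ^ 2

/-- A collection of `T` tasks; the `m`-th one has `n m` samples in `ℝ^D`. -/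
abbrev Samples (D T : ℕ) (n : Fin T → ℕ) : Type :=
  (m : Fin T) → Fin (n m) → EuclideanSpace ℝ (Fin D)

/-- The labels of the `T` tasks. -/
abbrev Labels (T : ℕ) (n : Fin T → ℕ) : Type :=
  (m : Fin T) → Fin (n m) → ℝ

/-- Every task is separable, i.e. has a nonempty feasible set. This is implied by joint
separability (a nonempty intersection of the feasible sets), which is not required. -/
def Separable {D T : ℕ} {n : Fin T → ℕ} (x : Samples D T n) (y : Labels T n) : Prop :=
  ∀ m, (feasibleSet (x m) (y m)).Nonempty

/-- `w 0, …, w k` are iterates of regularized continual learning with strength `lam`: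
`w 0 = 0`, and the iteration number `t + 1` (for `t < k`), in which the task `τ t` is learned
with the weighting matrix `B t`, moves from `w t` to a global minimizer `w (t + 1)` of the
regularized objective. -/
structure IsRegularizedIterates {D T k : ℕ} {n : Fin T → ℕ} (x : Samples D T n)
    (y : Labels T n) (τ : Fin k → Fin T) (B : Fin k → Matrix (Fin D) (Fin D) ℝ) (lam : ℝ)
    (w : Fin (k + 1) → EuclideanSpace ℝ (Fin D)) : Prop where
  init : w 0 = 0
  step : ∀ t : Fin k,
    IsMinOn (regularizedObjective (x (τ t)) (y (τ t)) (B t) lam (w t.castSucc)) Set.univ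
      (w t.succ)

/-- `v 0, …, v k` are iterates of the weighted Sequential Max-Margin scheme:
`v 0 = 0`, and `v (t + 1)` is a projection of `v t`, in the norm weighted by `B t`, onto the
feasible set of the task `τ t`. -/
structure IsMaxMarginIterates {D T k : ℕ} {n : Fin T → ℕ} (x : Samples D T n)
    (y : Labels T n) (τ : Fin k → Fin T) (B : Fin k → Matrix (Fin D) (Fin D) ℝ)
    (v : Fin (k + 1) → EuclideanSpace ℝ (Fin D)) : Prop where
  init : v 0 = 0
  feasible : ∀ t : Fin k, v t.succ ∈ feasibleSet (x (τ t)) (y (τ t))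
  step : ∀ t : Fin k,
    IsMinOn (fun u => weightedNorm (B t) (u - v t.castSucc) ^ 2)
      (feasibleSet (x (τ t)) (y (τ t))) (v t.succ)

end ContinualClassification

end

namespace ContinualClassification

/-! Put `l = log (1/λ)` and write the iterates as `l • z`, `l • p`. Divided by `λ`, the objective
becomes `∑ exp (l (1 - y ⟪z, x⟫)) + l²/2 ‖z - p‖_B²`. At a feasible `z` the sum is at most `N`,
negligible against `l²`; violating a margin by `ε` costs `exp (l ε)`, which dwarfs `l²`. So the
rescaled minimizer tends to the `B`-projection of `lim p` onto the feasible set: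
`tendsto_rescaled_minimizer`, by compactness and uniqueness of the projection. Induction on the step
gives `w_t^(λ) / l → w_t`. Since `w_t ≠ 0`, normalizing removes the factor `l`. -/

open scoped MatrixOrder Matrix.Norms.L2Operator in
/-- A positive definite weighting norm is the Euclidean norm after an injective linear map. -/
theorem exists_weightedNorm_eq_norm {D : ℕ} {B : Matrix (Fin D) (Fin D) ℝ} (hB : B.PosDef) :
    ∃ L : EuclideanSpace ℝ (Fin D) →L[ℝ] EuclideanSpace ℝ (Fin D),
      Function.Injective L ∧ ∀ v, weightedNorm B v = ‖L v‖ := by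
  -- Factoring `B = A* A` turns `vᵀ B v` into `‖A v‖²`.
  obtain ⟨A, rfl⟩ := CStarAlgebra.nonneg_iff_eq_star_mul_self.mp
    (Matrix.nonneg_iff_posSemidef.2 hB.posSemidef)
  have key : ∀ v : EuclideanSpace ℝ (Fin D),
      v.ofLp ⬝ᵥ (star A * A).mulVec v.ofLp = ‖Matrix.toEuclideanCLM (𝕜 := ℝ) A v‖ ^ 2 := by
    intro v
    rw [EuclideanSpace.real_norm_sq_eq, ← Matrix.mulVec_mulVec, Matrix.dotProduct_mulVec,
      Matrix.star_eq_conjTranspose, Matrix.conjTranspose_eq_transpose_of_trivial,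
      Matrix.vecMul_transpose]
    simp [dotProduct, pow_two]
  refine ⟨Matrix.toEuclideanCLM (𝕜 := ℝ) A, ?_, fun v => ?_⟩
  · refine (injective_iff_map_eq_zero _).2 fun v hv => ?_
    by_contra hne
    have h := hB.dotProduct_mulVec_pos (x := v.ofLp) (by simpa using hne)
    rw [star_trivial, key, hv] at h
    simp at h
  · rw [weightedNorm, key, Real.sqrt_sq (norm_nonneg _)]

/-- Coercive quadratic regularization of a nonnegative convex continuous function has exactly one
minimizer on a nonempty closed convex set. -/
theorem existsUnique_isMinOn_add_sq {E : Type*} [NormedAddCommGroup E] [InnerProductSpace ℝ E]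
    [FiniteDimensional ℝ E] {L : E →L[ℝ] E} (hL : Function.Injective L) {K : Set E}
    (hK : IsClosed K) (hKc : Convex ℝ K) (hKne : K.Nonempty) {g : E → ℝ} (hg : Continuous g)
    (hg0 : ∀ w, 0 ≤ g w) (hgc : ConvexOn ℝ K g) {a : ℝ} (ha : 0 < a) (u : E) :
    ∃! w, w ∈ K ∧ IsMinOn (fun w => g w + a * ‖L (w - u)‖ ^ 2) K w := by
  obtain ⟨x₀, hx₀⟩ := hKne
  have hcoer : Tendsto (fun w => a * ‖L (w - u)‖ ^ 2) (cocompact E) atTop := by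
    have h1 : Tendsto L (cocompact E) (cocompact E) :=
      (LinearMap.isClosedEmbedding_of_injective (f := (L : E →ₗ[ℝ] E))
        (LinearMap.ker_eq_bot.2 hL)).tendsto_cocompact
    have h2 : Tendsto (fun w => w - u) (cocompact E) (cocompact E) :=
      (Homeomorph.subRight u).isClosedEmbedding.tendsto_cocompact
    exact ((tendsto_pow_atTop two_ne_zero).comp
      ((tendsto_norm_cocompact_atTop).comp (h1.comp h2))).const_mul_atTop ha
  have hcont : Continuous fun w => g w + a * ‖L (w - u)‖ ^ 2 := by fun_prop
  obtain ⟨w, hwK, hw⟩ := hcont.continuousOn.exists_isMinOn' hK hx₀ (by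
    refine Filter.Eventually.filter_mono inf_le_left ?_
    filter_upwards [hcoer.eventually_ge_atTop (g x₀ + a * ‖L (x₀ - u)‖ ^ 2)] with w hw
    exact hw.trans (le_add_of_nonneg_left (hg0 w)))
  refine ⟨w, ⟨hwK, hw⟩, fun z ⟨hzK, hz⟩ => ?_⟩
  -- By the parallelogram law the midpoint would improve on two minimizers by at least `a/4 * ‖L (w
  -- - z)‖²`.
  set m := (1 / 2 : ℝ) • w + (1 / 2 : ℝ) • z with hm
  have hmK : m ∈ K := hKc hwK hzK (by norm_num) (by norm_num) (by norm_num)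
  have h1 : g ((1 / 2 : ℝ) • w + (1 / 2 : ℝ) • z) ≤ (1 / 2 : ℝ) • g w + (1 / 2 : ℝ) • g z :=
    hgc.2 hwK hzK (by norm_num) (by norm_num) (by norm_num)
  have h2 := isMinOn_iff.1 hw m hmK
  have h3 := isMinOn_iff.1 hz m hmK
  have h4 := parallelogram_law_with_norm ℝ (L (w - u)) (L (z - u))
  have h5 : L (w - u) + L (z - u) = (2 : ℝ) • L (m - u) := by
    rw [← map_add, ← map_smul]; congr 1; rw [hm]; module
  have h6 : L (w - u) - L (z - u) = L (w - z) := by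
    rw [← map_sub]; congr 1; abel
  rw [h5, h6, norm_smul, Real.norm_of_nonneg zero_le_two] at h4
  simp only [smul_eq_mul] at h1 h2 h3
  rw [← hm] at h1
  have h7 : a * ‖L (w - z)‖ ^ 2 ≤ 0 := by nlinarith
  have h8 : ‖L (w - z)‖ ^ 2 ≤ 0 := by
    by_contra h; exact absurd h7 (not_le.2 (mul_pos ha (not_le.1 h)))
  have h9 : L (w - z) = 0 := norm_eq_zero.1 (pow_eq_zero_iff two_ne_zero |>.1
    (le_antisymm h8 (sq_nonneg _)))
  exact (sub_eq_zero.1 (hL (h9.trans (map_zero L).symm))).symm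

variable {D N : ℕ}

theorem continuous_expLoss (x : Fin N → EuclideanSpace ℝ (Fin D)) (y : Fin N → ℝ) :
    Continuous (expLoss x y) := by
  unfold expLoss; fun_prop

theorem expLoss_nonneg (x : Fin N → EuclideanSpace ℝ (Fin D)) (y : Fin N → ℝ)
    (w : EuclideanSpace ℝ (Fin D)) : 0 ≤ expLoss x y w :=
  Finset.sum_nonneg fun _ _ => (Real.exp_pos _).le

theorem convexOn_expLoss (x : Fin N → EuclideanSpace ℝ (Fin D)) (y : Fin N → ℝ) :
    ConvexOn ℝ Set.univ (expLoss x y) := by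
  refine ⟨convex_univ, fun v _ w _ a b ha hb hab => ?_⟩
  simp only [expLoss, smul_eq_mul, Finset.mul_sum, ← Finset.sum_add_distrib]
  refine Finset.sum_le_sum fun i _ => ?_
  have h := convexOn_exp.2 (Set.mem_univ (-(y i * inner ℝ v (x i))))
    (Set.mem_univ (-(y i * inner ℝ w (x i)))) ha hb hab
  simp only [smul_eq_mul] at h
  refine le_trans (le_of_eq ?_) h
  rw [inner_add_left, real_inner_smul_left, real_inner_smul_left]
  ring_nf

theorem isClosed_feasibleSet (x : Fin N → EuclideanSpace ℝ (Fin D)) (y : Fin N → ℝ) :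
    IsClosed (feasibleSet x y) := by
  simp only [feasibleSet, Set.ofPred_forall]
  exact isClosed_iInter fun i => isClosed_le continuous_const (by fun_prop)

theorem convex_feasibleSet (x : Fin N → EuclideanSpace ℝ (Fin D)) (y : Fin N → ℝ) :
    Convex ℝ (feasibleSet x y) := by
  intro v hv w hw a b ha hb hab i
  rw [inner_add_left, real_inner_smul_left, real_inner_smul_left]
  nlinarith [mul_le_mul_of_nonneg_left (hv i) ha, mul_le_mul_of_nonneg_left (hw i) hb]

/-- The origin has margin `0 < 1` on any sample; this makes the limit direction meaningful. -/
theorem ne_zero_of_mem_feasibleSet {x : Fin N → EuclideanSpace ℝ (Fin D)} {y : Fin N → ℝ}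
    (hN : 0 < N) {v : EuclideanSpace ℝ (Fin D)} (hv : v ∈ feasibleSet x y) : v ≠ 0 := by
  rintro rfl
  have h := hv ⟨0, hN⟩
  rw [inner_zero_left, mul_zero] at h
  exact absurd h (by norm_num)

theorem existsUnique_isMinOn_regularizedObjective (x : Fin N → EuclideanSpace ℝ (Fin D))
    (y : Fin N → ℝ) {B : Matrix (Fin D) (Fin D) ℝ} (hB : B.PosDef) {lam : ℝ} (hlam : 0 < lam)
    (u : EuclideanSpace ℝ (Fin D)) :
    ∃! w, IsMinOn (regularizedObjective x y B lam u) Set.univ w := by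
  obtain ⟨L, hL, hBL⟩ := exists_weightedNorm_eq_norm hB
  have h := existsUnique_isMinOn_add_sq hL isClosed_univ convex_univ Set.univ_nonempty
    (continuous_expLoss x y) (expLoss_nonneg x y) (convexOn_expLoss x y) (half_pos hlam) u
  have e : regularizedObjective x y B lam u =
      fun w => expLoss x y w + lam / 2 * ‖L (w - u)‖ ^ 2 := by
    funext w; rw [regularizedObjective, hBL]
  simpa only [e, Set.mem_univ, true_and] using h

theorem existsUnique_isMinOn_weightedNorm {x : Fin N → EuclideanSpace ℝ (Fin D)}
    {y : Fin N → ℝ} (hne : (feasibleSet x y).Nonempty) {B : Matrix (Fin D) (Fin D) ℝ}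
    (hB : B.PosDef) (u : EuclideanSpace ℝ (Fin D)) :
    ∃! w, w ∈ feasibleSet x y ∧
      IsMinOn (fun z => weightedNorm B (z - u) ^ 2) (feasibleSet x y) w := by
  obtain ⟨L, hL, hBL⟩ := exists_weightedNorm_eq_norm hB
  have h := existsUnique_isMinOn_add_sq hL (isClosed_feasibleSet x y) (convex_feasibleSet x y) hne
    continuous_const (fun _ => le_rfl) (convexOn_const (0 : ℝ) (convex_feasibleSet x y))
    one_pos u
  simpa only [hBL, zero_add, one_mul] using h

/-- Recursion along `Fin (k + 1)` whose steps are uniquely solvable has exactly one solution. -/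
theorem existsUnique_fin_iterates {α : Type*} {k : ℕ} (a : α) {P : Fin k → α → α → Prop}
    (hP : ∀ t u, ∃! w, P t u w) :
    ∃! w : Fin (k + 1) → α, w 0 = a ∧ ∀ t : Fin k, P t (w t.castSucc) (w t.succ) := by
  choose f hf hfu using hP
  refine ⟨fun i => Fin.induction (motive := fun _ => α) a (fun t u => f t u) i,
    ⟨rfl, fun t => ?_⟩, fun w hw => ?_⟩
  · simpa only [Fin.induction_succ] using hf t _
  · funext i
    induction i using Fin.induction with
    | zero => exact hw.1
    | succ t ih =>
      simp only [Fin.induction_succ]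
      rw [← ih]
      exact hfu t _ _ (hw.2 t)

/-! ### The limit of a single step -/

/-- Comparing a minimizer of the regularized objective at strength `exp (-l)` with the rescaled
feasible point `l • v`. -/
theorem rescaled_objective_le {x : Fin N → EuclideanSpace ℝ (Fin D)} {y : Fin N → ℝ}
    {B : Matrix (Fin D) (Fin D) ℝ} {L : EuclideanSpace ℝ (Fin D) →L[ℝ] EuclideanSpace ℝ (Fin D)}
    (hBL : ∀ v, weightedNorm B v = ‖L v‖) {v : EuclideanSpace ℝ (Fin D)}
    (hv : v ∈ feasibleSet x y) {l : ℝ} (hl : 0 < l) {p z : EuclideanSpace ℝ (Fin D)}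
    (hz : IsMinOn (regularizedObjective x y B (Real.exp (-l)) (l • p)) Set.univ (l • z)) :
    (∑ i, Real.exp (l * (1 - y i * inner ℝ z (x i)))) + l ^ 2 / 2 * ‖L (z - p)‖ ^ 2 ≤
      N + l ^ 2 / 2 * ‖L (v - p)‖ ^ 2 := by
  have h := isMinOn_iff.1 hz (l • v) (Set.mem_univ _)
  simp only [regularizedObjective, hBL, ← smul_sub, map_smul, norm_smul,
    Real.norm_of_nonneg hl.le] at h
  -- Extracting `exp (-l)`, which is `λ`, lets it cancel against the same factor in the penalty.
  have hexp : ∀ s : EuclideanSpace ℝ (Fin D), expLoss x y (l • s) =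
      Real.exp (-l) * ∑ i, Real.exp (l * (1 - y i * inner ℝ s (x i))) := by
    intro s
    rw [expLoss, Finset.mul_sum]
    refine Finset.sum_congr rfl fun i _ => ?_
    rw [← Real.exp_add, real_inner_smul_left]
    ring_nf
  have hN : ∑ i, Real.exp (l * (1 - y i * inner ℝ v (x i))) ≤ N := by
    refine (Finset.sum_le_card_nsmul Finset.univ _ 1 fun i _ => ?_).trans (by simp)
    exact Real.exp_le_one_iff.2 (mul_nonpos_of_nonneg_of_nonpos hl.le (sub_nonpos.2 (hv i)))
  rw [hexp, hexp] at h
  refine le_trans (le_of_mul_le_mul_left ?_ (Real.exp_pos (-l))) (add_le_add_left hN _)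
  linear_combination h

/-- One step: if the rescaled previous iterates converge, the rescaled minimizers converge to the
weighted projection of the limit onto the feasible set. -/
theorem tendsto_rescaled_minimizer {ι : Type*} {F : Filter ι}
    {x : Fin N → EuclideanSpace ℝ (Fin D)} {y : Fin N → ℝ} {B : Matrix (Fin D) (Fin D) ℝ}
    (hB : B.PosDef) {p₀ v : EuclideanSpace ℝ (Fin D)} (hv : v ∈ feasibleSet x y)
    (hmin : IsMinOn (fun u => weightedNorm B (u - p₀) ^ 2) (feasibleSet x y) v)
    {l : ι → ℝ} (hl : Tendsto l F atTop) {p z : ι → EuclideanSpace ℝ (Fin D)}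
    (hp : Tendsto p F (𝓝 p₀))
    (hz : ∀ᶠ j in F, IsMinOn (regularizedObjective x y B (Real.exp (-l j)) (l j • p j)) Set.univ
      (l j • z j)) :
    Tendsto z F (𝓝 v) := by
  obtain ⟨L, hL, hBL⟩ := exists_weightedNorm_eq_norm hB
  obtain ⟨c, -, hLc⟩ := LinearMap.exists_antilipschitzWith
    (L : EuclideanSpace ℝ (Fin D) →ₗ[ℝ] EuclideanSpace ℝ (Fin D)) (LinearMap.ker_eq_bot.2 hL)
  have hmain : ∀ᶠ j in F, (∑ i, Real.exp (l j * (1 - y i * inner ℝ (z j) (x i)))) +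
      l j ^ 2 / 2 * ‖L (z j - p j)‖ ^ 2 ≤ N + l j ^ 2 / 2 * ‖L (v - p j)‖ ^ 2 := by
    filter_upwards [hz, hl.eventually_gt_atTop 0] with j hj hlj
    exact rescaled_objective_le hBL hv hlj hj
  have hdist : ∀ᶠ j in F, ‖L (z j - p j)‖ ^ 2 ≤ 2 * N / l j ^ 2 + ‖L (v - p j)‖ ^ 2 := by
    filter_upwards [hmain, hl.eventually_gt_atTop 0] with j hj hlj
    have h0 : 0 ≤ ∑ i, Real.exp (l j * (1 - y i * inner ℝ (z j) (x i))) :=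
      Finset.sum_nonneg fun _ _ => (Real.exp_pos _).le
    have h1 : l j ^ 2 * ‖L (z j - p j)‖ ^ 2 ≤
        l j ^ 2 * (2 * N / l j ^ 2 + ‖L (v - p j)‖ ^ 2) := by
      rw [mul_add, mul_div_cancel₀ _ (by positivity)]; linarith
    exact le_of_mul_le_mul_left h1 (by positivity)
  have hvp : Tendsto (fun j => ‖L (v - p j)‖ ^ 2) F (𝓝 (‖L (v - p₀)‖ ^ 2)) :=
    ((L.continuous.tendsto _).comp (tendsto_const_nhds.sub hp)).norm.pow 2
  have hbound : Tendsto (fun j => 2 * N / l j ^ 2 + ‖L (v - p j)‖ ^ 2) F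
      (𝓝 (‖L (v - p₀)‖ ^ 2)) := by
    have h1 : Tendsto (fun j => 2 * (N : ℝ) / l j ^ 2) F (𝓝 0) :=
      tendsto_const_nhds.div_atTop ((tendsto_pow_atTop two_ne_zero).comp hl)
    simpa using h1.add hvp
  -- The extra `1` gives slack for eventual bounds and keeps `R` positive.
  set R : ℝ := ‖L (v - p₀)‖ ^ 2 + 1
  have hRev : ∀ᶠ j in F, ‖L (z j - p j)‖ ^ 2 ≤ R := by
    filter_upwards [hdist, hbound.eventually_le_const (lt_add_one _)] with j h1 h2
    exact h1.trans h2
  have hball : ∀ᶠ j in F, z j ∈ Metric.closedBall (0 : EuclideanSpace ℝ (Fin D))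
      (c * √R + (‖p₀‖ + 1)) := by
    filter_upwards [hRev, hp.norm.eventually_le_const (lt_add_one _)] with j h1 h2
    rw [mem_closedBall_zero_iff]
    have h3 : ‖z j - p j‖ ≤ c * ‖L (z j - p j)‖ := by
      simpa using hLc.le_mul_dist (z j - p j) 0
    have h4 : ‖L (z j - p j)‖ ≤ √R := Real.le_sqrt_of_sq_le h1
    calc ‖z j‖ = ‖(z j - p j) + p j‖ := by rw [sub_add_cancel]
      _ ≤ ‖z j - p j‖ + ‖p j‖ := norm_add_le _ _
      _ ≤ c * √R + (‖p₀‖ + 1) :=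
        add_le_add (h3.trans (mul_le_mul_of_nonneg_left h4 c.2)) h2
  -- By boundedness it is enough to show that `v` is the only cluster point.
  refine (isCompact_closedBall _ _).tendsto_nhds_of_unique_mapClusterPt hball fun q _ hq => ?_
  obtain ⟨U, hUF, hU⟩ := mapClusterPt_iff_ultrafilter.1 hq
  have hqdist : ‖L (q - p₀)‖ ^ 2 ≤ ‖L (v - p₀)‖ ^ 2 :=
    le_of_tendsto_of_tendsto
      (((L.continuous.tendsto _).comp (hU.sub (hp.mono_left hUF))).norm.pow 2)
      (hbound.mono_left hUF) (hUF hdist)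
  have hqmem : q ∈ feasibleSet x y := by
    intro i
    by_contra hlt
    rw [not_le] at hlt
    obtain ⟨ε, hε, hεq⟩ : ∃ ε : ℝ, 0 < ε ∧ ε < 1 - y i * inner ℝ q (x i) :=
      exists_between (sub_pos.2 hlt)
    have hlim : Tendsto (fun j => 1 - y i * inner ℝ (z j) (x i)) U
        (𝓝 (1 - y i * inner ℝ q (x i))) :=
      tendsto_const_nhds.sub ((hU.inner tendsto_const_nhds).const_mul _)
    have hlU := hl.mono_left hUF
    have hRv : ∀ᶠ j in F, ‖L (v - p j)‖ ^ 2 ≤ R := hvp.eventually_le_const (lt_add_one _)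
    -- A cubic lower bound on `exp` suffices against `l²`: the last threshold makes `(l ε)³/6`
    -- exceed `l² (N + R)`.
    obtain ⟨j, h1, h2, h3, h4, h5⟩ := ((hlim.eventually_const_lt hεq).and
      ((hmain.filter_mono hUF).and ((hRv.filter_mono hUF).and ((hlU.eventually_gt_atTop 1).and
        (hlU.eventually_gt_atTop (6 * (N + R) / ε ^ 3)))))).exists
    have hl0 : 0 < l j := one_pos.trans h4
    have h6 : (l j * ε) ^ 3 / 6 ≤ N + l j ^ 2 / 2 * R :=
      calc (l j * ε) ^ 3 / 6 ≤ Real.exp (l j * ε) := by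
            simpa [Nat.factorial] using
              Real.pow_div_factorial_le_exp (l j * ε) (mul_pos hl0 hε).le 3
        _ ≤ Real.exp (l j * (1 - y i * inner ℝ (z j) (x i))) :=
            Real.exp_le_exp.2 (mul_le_mul_of_nonneg_left h1.le hl0.le)
        _ ≤ ∑ i, Real.exp (l j * (1 - y i * inner ℝ (z j) (x i))) :=
            Finset.single_le_sum (f := fun i => Real.exp (l j * (1 - y i * inner ℝ (z j) (x i))))
              (fun _ _ => (Real.exp_pos _).le) (Finset.mem_univ i)
        _ ≤ N + l j ^ 2 / 2 * R := by
            have h7 : 0 ≤ l j ^ 2 / 2 * ‖L (z j - p j)‖ ^ 2 := by positivity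
            have h8 : l j ^ 2 / 2 * ‖L (v - p j)‖ ^ 2 ≤ l j ^ 2 / 2 * R :=
              mul_le_mul_of_nonneg_left h3 (by positivity)
            linarith
    have hR0 : 0 < R := by positivity
    have h9 : (N : ℝ) + l j ^ 2 / 2 * R ≤ l j ^ 2 * (N + R) := by
      have h10 : (1 : ℝ) ≤ l j ^ 2 := one_le_pow₀ h4.le
      nlinarith [mul_le_mul_of_nonneg_right h10 (Nat.cast_nonneg (α := ℝ) N),
        mul_pos (pow_pos hl0 2) hR0]
    rw [div_lt_iff₀ (by positivity)] at h5
    have h11 := mul_lt_mul_of_pos_left h5 (pow_pos hl0 2)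
    nlinarith
  have hqmin : IsMinOn (fun u => weightedNorm B (u - p₀) ^ 2) (feasibleSet x y) q := by
    refine isMinOn_iff.2 fun u hu => le_trans ?_ (isMinOn_iff.1 hmin u hu)
    simpa only [hBL] using hqdist
  exact (existsUnique_isMinOn_weightedNorm ⟨v, hv⟩ hB p₀).unique ⟨hqmem, hqmin⟩ ⟨hv, hmin⟩

/-! ### Induction along the task sequence -/

variable {T k : ℕ} {n : Fin T → ℕ} {x : Samples D T n} {y : Labels T n} {τ : Fin k → Fin T}
  {B : Fin k → Matrix (Fin D) (Fin D) ℝ}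

/-- The regularized iterates grow like `log (1 / λ)` times the max-margin iterates. -/
theorem tendsto_rescaled_iterates (hB : ∀ t, (B t).PosDef)
    {w : ℝ → Fin (k + 1) → EuclideanSpace ℝ (Fin D)} {v : Fin (k + 1) → EuclideanSpace ℝ (Fin D)}
    (hw : ∀ lam : ℝ, 0 < lam → IsRegularizedIterates x y τ B lam (w lam))
    (hv : IsMaxMarginIterates x y τ B v) (i : Fin (k + 1)) :
    Tendsto (fun lam => (-Real.log lam)⁻¹ • w lam i) (𝓝[>] 0) (𝓝 (v i)) := by
  have hlog : Tendsto (fun lam => -Real.log lam) (𝓝[>] 0) atTop :=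
    tendsto_neg_atBot_atTop.comp Real.tendsto_log_nhdsGT_zero
  induction i using Fin.induction with
  | zero =>
    rw [hv.init]
    refine tendsto_const_nhds.congr' ?_
    filter_upwards [self_mem_nhdsWithin] with lam hlam
    rw [(hw lam hlam).init, smul_zero]
  | succ t ih =>
    refine tendsto_rescaled_minimizer (hB t) (hv.feasible t) (hv.step t) hlog ih ?_
    filter_upwards [self_mem_nhdsWithin, hlog.eventually_gt_atTop 0] with lam hlam hpos
    rw [neg_neg, Real.exp_log hlam, smul_inv_smul₀ hpos.ne', smul_inv_smul₀ hpos.ne']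
    exact (hw lam hlam).step t

theorem existsUnique_isRegularizedIterates (x : Samples D T n) (y : Labels T n)
    (τ : Fin k → Fin T) (hB : ∀ t, (B t).PosDef) {lam : ℝ} (hlam : 0 < lam) :
    ∃! w : Fin (k + 1) → EuclideanSpace ℝ (Fin D), IsRegularizedIterates x y τ B lam w := by
  obtain ⟨w, hw, hu⟩ := existsUnique_fin_iterates (0 : EuclideanSpace ℝ (Fin D)) fun t u =>
    existsUnique_isMinOn_regularizedObjective (x (τ t)) (y (τ t)) (hB t) hlam u
  exact ⟨w, ⟨hw.1, hw.2⟩, fun z hz => hu z ⟨hz.init, hz.step⟩⟩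

theorem existsUnique_isMaxMarginIterates (τ : Fin k → Fin T) (hB : ∀ t, (B t).PosDef)
    (hsep : Separable x y) :
    ∃! v : Fin (k + 1) → EuclideanSpace ℝ (Fin D), IsMaxMarginIterates x y τ B v := by
  obtain ⟨v, hv, hu⟩ := existsUnique_fin_iterates (0 : EuclideanSpace ℝ (Fin D)) fun t u =>
    existsUnique_isMinOn_weightedNorm (hsep (τ t)) (hB t) u
  exact ⟨v, ⟨hv.1, fun t => (hv.2 t).1, fun t => (hv.2 t).2⟩,
    fun z hz => hu z ⟨hz.init, fun t => ⟨hz.feasible t, hz.step t⟩⟩⟩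

/-- Convergence after a positive rescaling implies convergence in direction. -/
theorem tendsto_direction_of_tendsto_smul {ι E : Type*} [NormedAddCommGroup E] [NormedSpace ℝ E]
    {F : Filter ι} {a : ι → ℝ} (ha : ∀ᶠ j in F, 0 < a j) {w : ι → E} {v : E} (hv : v ≠ 0)
    (h : Tendsto (fun j => a j • w j) F (𝓝 v)) :
    Tendsto (fun j => ‖w j‖⁻¹ • w j) F (𝓝 (‖v‖⁻¹ • v)) := by
  refine ((h.norm.inv₀ (norm_ne_zero_iff.2 hv)).smul h).congr' ?_
  filter_upwards [ha] with j hj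
  rw [norm_smul, Real.norm_of_nonneg hj.le, smul_smul, mul_inv, mul_right_comm,
    inv_mul_cancel₀ hj.ne', one_mul]

end ContinualClassification

/-- For every choice of labels and (Lebesgue-)almost every choice of samples that makes all
tasks separable, for every task ordering `τ` of any length `k` and all positive definite
weighting matrices with spectra in a common interval `[μ, M]`, `0 < μ`: both schemes are well
defined, and the regularized iterates converge in direction, as the regularization strength
tends to `0` from the right, to the (nonzero) weighted Sequential Max-Margin iterates. -/
theorem theorem6 (D T : ℕ) (n : Fin T → ℕ) (hn : ∀ m, 0 < n m)
    (y : ContinualClassification.Labels T n) (hy : ∀ m i, y m i = 1 ∨ y m i = -1) :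
    ∀ᵐ x : ContinualClassification.Samples D T n ∂volume,
      ContinualClassification.Separable x y →
      ∀ (k : ℕ) (τ : Fin k → Fin T) (B : Fin k → Matrix (Fin D) (Fin D) ℝ) (μ M : ℝ),
        0 < μ → (∀ t, (B t).PosDef) → (∀ t, spectrum ℝ (B t) ⊆ Set.Icc μ M) →
        (∀ lam : ℝ, 0 < lam →
          ∃! w : Fin (k + 1) → EuclideanSpace ℝ (Fin D),
            ContinualClassification.IsRegularizedIterates x y τ B lam w) ∧
        (∃! v : Fin (k + 1) → EuclideanSpace ℝ (Fin D),
            ContinualClassification.IsMaxMarginIterates x y τ B v) ∧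
        ∀ (w : ℝ → Fin (k + 1) → EuclideanSpace ℝ (Fin D))
          (v : Fin (k + 1) → EuclideanSpace ℝ (Fin D)),
          (∀ lam : ℝ, 0 < lam →
            ContinualClassification.IsRegularizedIterates x y τ B lam (w lam)) →
          ContinualClassification.IsMaxMarginIterates x y τ B v →
          ∀ t : Fin k,
            v t.succ ≠ 0 ∧
            Tendsto (fun lam : ℝ => ‖w lam t.succ‖⁻¹ • w lam t.succ) (𝓝[>] (0 : ℝ))
              (𝓝 (‖v t.succ‖⁻¹ • v t.succ)) := by
  -- The argument works for every separable sample, so the exceptional null set is empty.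
  refine Filter.Eventually.of_forall fun x hsep k τ B μ M _ hB _ =>
    ⟨fun lam hlam => ContinualClassification.existsUnique_isRegularizedIterates x y τ hB hlam,
      ContinualClassification.existsUnique_isMaxMarginIterates τ hB hsep,
      fun w v hw hv t => ?_⟩
  have hne : v t.succ ≠ 0 :=
    ContinualClassification.ne_zero_of_mem_feasibleSet (hn (τ t)) (hv.feasible t)
  refine ⟨hne, ContinualClassification.tendsto_direction_of_tendsto_smul ?_ hne
    (ContinualClassification.tendsto_rescaled_iterates hB hw hv t.succ)⟩
  have hlog : Tendsto (fun lam => -Real.log lam) (𝓝[>] 0) atTop :=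
    tendsto_neg_atBot_atTop.comp Real.tendsto_log_nhdsGT_zero
  -- The scale `-log λ` is positive only once `λ < 1`.
  filter_upwards [hlog.eventually_gt_atTop 0] with lam hlam
  exact inv_pos.2 hlam
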